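/- Let $n \ge 1$ be an integer, let $[n] = \{1, \dots, n\}$ with its usual order, and let $\mathcal{OF}_n$ be the monoid, under composition, of all order-preserving functions $f : [n] \to [n]$ (that is, $i \le j$ implies $f(i) \le f(j)$) such that $f(n) = n$. Then for every field $\Bbbk$ the monoid algebra $\Bbbk\mathcal{OF}_n$ is semisimple. -/

import Mathlib

/-- The monoid `OF n` of all order-preserving functions `f : [n] → [n]` with `f n = n`, as a
submonoid of the monoid (under composition) of all order-preserving functions `[n] → [n]`.
The chain `[n]`, with `n ≥ 1`, is modelled by `Fin n`, so its largest element `n` is `⊤`. -/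
def OF (n : ℕ) [NeZero n] : Submonoid (Fin n →o Fin n) where
  carrier := {f | f ⊤ = ⊤}
  one_mem' := rfl
  mul_mem' {f _} hf hg := (congrArg f hg).trans hf

/-! The action on `r`-element subsets containing `⊤`, with collapsed subsets sent to zero, maps the
monoid algebra to a product of matrix algebras over the field, which is semisimple; this map is an
isomorphism. It is injective by triangularity for the pointwise order: if `f` and `g` send the fibre
maxima of `g` to the same set, then `f ≤ g`. It is surjective by dimension, since each pair of such
subsets of equal size is the set of fibre maxima and the image of some function in the monoid. -/

namespace OF

/-- The set of maxima of the fibres of `g`. -/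
def fibreMaxima {n : ℕ} (g : Fin n → Fin n) : Finset (Fin n) := {x | ∀ y, x < y → g x < g y}

theorem mem_fibreMaxima {n : ℕ} {g : Fin n → Fin n} {x : Fin n} :
    x ∈ fibreMaxima g ↔ ∀ y, x < y → g x < g y := by simp [fibreMaxima]

theorem strictMonoOn_fibreMaxima {n : ℕ} (g : Fin n → Fin n) : StrictMonoOn g (fibreMaxima g) :=
  fun _ hx y _ h => mem_fibreMaxima.1 hx y h

theorem exists_mem_fibreMaxima {n : ℕ} (g : Fin n →o Fin n) (x : Fin n) :
    ∃ m ∈ fibreMaxima g, x ≤ m ∧ g m = g x := by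
  have hne : ({y | g y = g x} : Finset (Fin n)).Nonempty := ⟨x, by simp⟩
  obtain ⟨m, hm, hmax⟩ := Finset.exists_max_image _ id hne
  simp only [Finset.mem_filter, Finset.mem_univ, true_and, id] at hm hmax
  refine ⟨m, mem_fibreMaxima.2 fun y hy => ?_, hmax x rfl, hm⟩
  refine lt_of_le_of_ne (g.monotone hy.le) fun h => ?_
  exact absurd (hmax y (h ▸ hm)) (not_le.2 hy)

/-- Two monotone functions with the same image of full size on a finite set agree on it. -/
theorem eqOn_of_image_eq {α β : Type*} [LinearOrder α] [LinearOrder β] {f g : α → β}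
    {M : Finset α} (hf : Monotone f) (hg : StrictMonoOn g M) (h : M.image f = M.image g) :
    Set.EqOn f g M := by
  have hcg : (M.image g).card = M.card := Finset.card_image_of_injOn hg.injOn
  have hfi : Set.InjOn f M := Finset.card_image_iff.1 (h ▸ hcg)
  have hfs : StrictMonoOn f M := fun x hx y hy hxy =>
    lt_of_le_of_ne (hf hxy.le) fun e => hxy.ne (hfi hx hy e)
  let e := M.orderEmbOfFin rfl
  have he : ∀ i, e i ∈ M := M.orderEmbOfFin_mem rfl
  -- Composed with the increasing enumeration of `M`, both functions enumerate the same set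
  -- increasingly, and such an enumeration is unique.
  have h1 : (f ∘ e) = (M.image g).orderEmbOfFin hcg :=
    Finset.orderEmbOfFin_unique hcg (fun i => h ▸ Finset.mem_image_of_mem f (he i))
      fun i j hij => hfs (he i) (he j) (e.strictMono hij)
  have h2 : (g ∘ e) = (M.image g).orderEmbOfFin hcg :=
    Finset.orderEmbOfFin_unique hcg (fun i => Finset.mem_image_of_mem g (he i))
      fun i j hij => hg (he i) (he j) (e.strictMono hij)
  intro x hx
  have hx' : x ∈ Set.range e := by rw [M.range_orderEmbOfFin rfl]; exact hx
  obtain ⟨i, rfl⟩ := hx'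
  exact congrFun (h1.trans h2.symm) i

/-- Moving `x` up to the maximum of its `g`-fibre leaves `g x` unchanged and can only increase `f
x`; there the two functions agree. -/
theorem le_of_image_fibreMaxima_eq {n : ℕ} {f g : Fin n →o Fin n}
    (h : (fibreMaxima g).image f = (fibreMaxima g).image g) : f ≤ g := by
  intro x
  obtain ⟨m, hm, hxm, hgm⟩ := exists_mem_fibreMaxima g x
  calc f x ≤ f m := f.monotone hxm
    _ = g m := eqOn_of_image_eq f.monotone (strictMonoOn_fibreMaxima g) h hm
    _ = g x := hgm

variable {n : ℕ} [NeZero n]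

instance : Finite (OF n) :=
  Finite.of_injective (fun f : OF n => (f.1 : Fin n → Fin n))
    fun _ _ h => Subtype.ext (DFunLike.coe_injective h)

/-- The subsets of `Fin n` of size `r` that contain `⊤`. -/
abbrev TopSubset (n : ℕ) [NeZero n] (r : ℕ) : Type :=
  {A : Finset (Fin n) // ⊤ ∈ A ∧ A.card = r}

/-- A function fixing `⊤` acts on the subsets of size `r` containing `⊤` by direct image, where
the image counts as zero if it has fewer than `r` elements. -/
def imageRep (k : Type*) [Field k] (n : ℕ) [NeZero n] (r : ℕ) :
    OF n →* Matrix (TopSubset n r) (TopSubset n r) k where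
  toFun f := Matrix.of fun B A => if A.1.image f.1 = B.1 then 1 else 0
  map_one' := by
    ext B A
    have h : A.1.image ((1 : OF n).1) = A.1 := Finset.image_id
    simp only [Matrix.of_apply, h, Matrix.one_apply, Subtype.ext_iff, eq_comm]
  map_mul' f g := by
    ext B A
    have himg : A.1.image ((f * g).1) = (A.1.image g.1).image f.1 := by
      rw [Finset.image_image]; rfl
    simp only [Matrix.mul_apply, Matrix.of_apply, himg]
    by_cases hc : (A.1.image g.1).card = r
    · have htop : (⊤ : Fin n) ∈ A.1.image g.1 := Finset.mem_image.2 ⟨⊤, A.2.1, g.2⟩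
      rw [Finset.sum_eq_single (⟨A.1.image g.1, htop, hc⟩ : TopSubset n r)]
      · simp
      · intro C _ hC
        rw [if_neg (c := A.1.image g.1 = C.1) (fun h => hC (Subtype.ext h.symm)), mul_zero]
      · simp
    -- If `g` collapses `A`, then `f` cannot restore its size, so both sides vanish.
    · rw [Finset.sum_eq_zero, if_neg]
      · intro h
        have h1 : r ≤ (A.1.image g.1).card := by
          conv_lhs => rw [← B.2.2, ← h]
          exact Finset.card_image_le
        have h2 : (A.1.image g.1).card ≤ r := Finset.card_image_le.trans_eq A.2.2
        exact hc (le_antisymm h2 h1)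
      · intro C _
        rw [if_neg (c := A.1.image g.1 = C.1) (fun h => hc (h ▸ C.2.2)), mul_zero]

theorem imageRep_apply (k : Type*) [Field k] (r : ℕ) (f : OF n) (B A : TopSubset n r) :
    imageRep k n r f B A = if A.1.image f.1 = B.1 then 1 else 0 := rfl

theorem top_mem_fibreMaxima (g : Fin n → Fin n) : ⊤ ∈ fibreMaxima g :=
  mem_fibreMaxima.2 fun _ h => absurd h not_top_lt

/-- The least element of `A` that is at least `x`. -/
def next {r : ℕ} (A : TopSubset n r) (x : Fin n) : Fin n :=
  (A.1.filter (x ≤ ·)).min' ⟨⊤, Finset.mem_filter.2 ⟨A.2.1, le_top⟩⟩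

theorem next_mem_filter {r : ℕ} (A : TopSubset n r) (x : Fin n) :
    next A x ∈ A.1.filter (x ≤ ·) := Finset.min'_mem _ _

theorem next_mem {r : ℕ} (A : TopSubset n r) (x : Fin n) : next A x ∈ A.1 :=
  (Finset.mem_filter.1 (next_mem_filter A x)).1

theorem le_next {r : ℕ} (A : TopSubset n r) (x : Fin n) : x ≤ next A x :=
  (Finset.mem_filter.1 (next_mem_filter A x)).2

theorem next_le {r : ℕ} (A : TopSubset n r) {x y : Fin n} (hy : y ∈ A.1) (h : x ≤ y) :
    next A x ≤ y := Finset.min'_le _ _ (Finset.mem_filter.2 ⟨hy, h⟩)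

theorem next_of_mem {r : ℕ} (A : TopSubset n r) {x : Fin n} (hx : x ∈ A.1) : next A x = x :=
  le_antisymm (next_le A hx le_rfl) (le_next A x)

theorem next_mono {r : ℕ} (A : TopSubset n r) : Monotone (next A) :=
  fun _ y h => next_le A (next_mem A y) (h.trans (le_next A y))

/-- The order isomorphism between two subsets of the same size. -/
def subsetIso {r : ℕ} (A B : TopSubset n r) : A.1 ≃o B.1 :=
  (A.1.orderIsoOfFin A.2.2).symm.trans (B.1.orderIsoOfFin B.2.2)

/-- The function with set of fibre maxima `A` and image `B`. -/
def ofMaximaImage {r : ℕ} (A B : TopSubset n r) : OF n where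
  val :=
    { toFun := fun x => subsetIso A B ⟨next A x, next_mem A x⟩
      monotone' := fun _ _ h => (subsetIso A B).monotone (next_mono A h) }
  property := by
    obtain ⟨a, ha⟩ := (subsetIso A B).surjective ⟨⊤, B.2.1⟩
    refine top_le_iff.1 ?_
    have h : subsetIso A B a ≤ subsetIso A B ⟨next A ⊤, next_mem A ⊤⟩ :=
      (subsetIso A B).monotone (le_top.trans (le_next A ⊤) : a.1 ≤ next A ⊤)
    rw [ha] at h
    exact h

theorem ofMaximaImage_apply {r : ℕ} (A B : TopSubset n r) (x : Fin n) :
    (ofMaximaImage A B).1 x = subsetIso A B ⟨next A x, next_mem A x⟩ := rfl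

theorem image_ofMaximaImage {r : ℕ} (A B : TopSubset n r) :
    Finset.univ.image (ofMaximaImage A B).1 = B.1 := by
  ext b
  simp only [Finset.mem_image, Finset.mem_univ, true_and, ofMaximaImage_apply]
  constructor
  · rintro ⟨x, rfl⟩
    exact Subtype.prop _
  · intro hb
    obtain ⟨⟨a, haA⟩, ha⟩ := (subsetIso A B).surjective ⟨b, hb⟩
    refine ⟨a, ?_⟩
    simp only [next_of_mem A haA, ha]

theorem fibreMaxima_ofMaximaImage {r : ℕ} (A B : TopSubset n r) :
    fibreMaxima (ofMaximaImage A B).1 = A.1 := by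
  ext x
  rw [mem_fibreMaxima]
  constructor
  · intro h
    by_contra hx
    have hlt : x < next A x :=
      lt_of_le_of_ne (le_next A x) fun e => hx (e ▸ next_mem A x)
    have := h _ hlt
    simp only [ofMaximaImage_apply, next_of_mem A (next_mem A x), lt_self_iff_false] at this
  · intro hx y hy
    refine (subsetIso A B).strictMono (?_ : next A x < next A y)
    rw [next_of_mem A hx]
    exact hy.trans_le (le_next A y)

/-- The fibre maxima recover `A` and the image recovers `B`. This bounds the total number of matrix
entries by the order of the monoid. -/
theorem ofMaximaImage_injective :
    Function.Injective fun p : Σ r : Fin (n + 1), TopSubset n r × TopSubset n r =>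
      ofMaximaImage p.2.1 p.2.2 := by
  rintro ⟨r, A, B⟩ ⟨s, A', B'⟩ h
  have hA : A.1 = A'.1 := by
    rw [← fibreMaxima_ofMaximaImage A B, ← fibreMaxima_ofMaximaImage A' B']
    exact congrArg (fun f : OF n => fibreMaxima f.1) h
  have hB : B.1 = B'.1 := by
    rw [← image_ofMaximaImage A B, ← image_ofMaximaImage A' B']
    exact congrArg (fun f : OF n => Finset.univ.image f.1) h
  obtain rfl : r = s := Fin.ext (by rw [← A.2.2, ← A'.2.2, hA])
  obtain rfl := Subtype.ext hA
  obtain rfl := Subtype.ext hB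
  rfl

/-- The sum of the representations of the monoid algebra on subsets of all sizes. -/
noncomputable def toMatrices (k : Type*) [Field k] (n : ℕ) [NeZero n] :
    MonoidAlgebra k (OF n) →ₐ[k] Π r : Fin (n + 1), Matrix (TopSubset n r) (TopSubset n r) k :=
  MonoidAlgebra.lift k _ (OF n) (MonoidHom.pi fun r : Fin (n + 1) => imageRep k n r)

theorem toMatrices_apply (k : Type*) [Field k] (c : MonoidAlgebra k (OF n)) (r : Fin (n + 1))
    (B A : TopSubset n r) :
    toMatrices k n c r B A = c.coeff.sum fun f a => if A.1.image f.1 = B.1 then a else 0 := by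
  rw [toMatrices, MonoidAlgebra.lift_apply, Finsupp.sum, Finset.sum_apply, Matrix.sum_apply]
  refine Finset.sum_congr rfl fun f _ => ?_
  simp [imageRep_apply]

theorem toMatrices_injective (k : Type*) [Field k] : Function.Injective (toMatrices k n) := by
  rw [injective_iff_map_eq_zero]
  intro c hc
  by_contra hne
  obtain ⟨g, hg⟩ := c.coeff.support.exists_minimal
    (Finsupp.support_nonempty_iff.2 fun h => hne (MonoidAlgebra.coeff_eq_zero.1 h))
  have hcard : ((fibreMaxima g.1).image g.1).card = (fibreMaxima g.1).card :=
    Finset.card_image_of_injOn (strictMonoOn_fibreMaxima g.1).injOn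
  let r : Fin (n + 1) := ⟨(fibreMaxima g.1).card,
    Nat.lt_succ_of_le ((Finset.card_le_univ _).trans_eq (Fintype.card_fin n))⟩
  let A : TopSubset n r := ⟨fibreMaxima g.1, top_mem_fibreMaxima _, rfl⟩
  let B : TopSubset n r := ⟨(fibreMaxima g.1).image g.1,
    Finset.mem_image.2 ⟨⊤, top_mem_fibreMaxima _, g.2⟩, hcard⟩
  -- By minimality of `g` in the support, this entry is exactly the coefficient of `g`.
  have h := toMatrices_apply k c r B A
  rw [hc, Finsupp.sum, Finset.sum_eq_single g] at h
  · rw [if_pos rfl] at h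
    exact Finsupp.mem_support_iff.1 hg.1 h.symm
  · intro f hf hfg
    refine if_neg fun himg => hfg ?_
    have hle : f ≤ g := le_of_image_fibreMaxima_eq himg
    exact le_antisymm hle (hg.2 hf hle)
  · exact fun hg' => absurd hg.1 hg'

theorem toMatrices_bijective (k : Type*) [Field k] : Function.Bijective (toMatrices k n) := by
  have : Fintype (OF n) := Fintype.ofFinite _
  have hinj := toMatrices_injective (n := n) k
  have hdim : Module.finrank k (MonoidAlgebra k (OF n)) = Fintype.card (OF n) :=
    ((MonoidAlgebra.coeffLinearEquiv k).finrank_eq).trans (Module.finrank_finsupp_self k)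
  have : Module.Finite k (MonoidAlgebra k (OF n)) :=
    Module.Finite.equiv (MonoidAlgebra.coeffLinearEquiv (S := k) (M := OF n) k).symm
  refine ⟨hinj, (LinearMap.injective_iff_surjective_of_finrank_eq_finrank
    (f := (toMatrices k n).toLinearMap) (le_antisymm ?_ ?_)).1 hinj⟩
  · exact LinearMap.finrank_le_finrank_of_injective (f := (toMatrices k n).toLinearMap) hinj
  · rw [hdim, Module.finrank_pi_fintype]
    refine le_of_eq_of_le ?_ (Fintype.card_le_of_injective _ (ofMaximaImage_injective (n := n)))
    simp [Fintype.card_sigma, Module.finrank_matrix]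

end OF

/-- For every field `k` and every `n ≥ 1`, the monoid algebra `k OF_n` is semisimple. -/
theorem mainTheorem7 (k : Type*) [Field k] (n : ℕ) [NeZero n] :
    IsSemisimpleRing (MonoidAlgebra k (OF n)) :=
  (AlgEquiv.ofBijective (OF.toMatrices k n)
    (OF.toMatrices_bijective k)).symm.toRingEquiv.isSemisimpleRing
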